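/- An expression environment is a tuple $\mathcal{E}=(\Sigma,\Gamma,\mathcal{P},\mathcal{F})$ where $\Sigma$ (letters) and $\Gamma$ (variables) are finite alphabets, $\mathcal{P}=(\mathcal{P}_k)_{k\in\mathbb{N}}$ is a family of sets of $k$-ary predicate symbols and $\mathcal{F}=(\mathcal{F}_k)_{k\in\mathbb{N}}$ is a family of sets of $k$-ary function symbols, with $\Sigma\cup\{\varepsilon\}\subset\mathcal{F}_0$ and $\cdot\in\mathcal{F}_2$. Boolean formulae $\phi$ are built from atoms $P(t_1,\dots,t_k)$, where $P\in\mathcal{P}_k$ and $t_1,\dots,t_k$ are terms over $\mathcal{F}$ with variables in $\Gamma$, by arbitrary $k$-ary boolean operators. Constrained expressions over $\mathcal{E}$ are given by the grammar $$E ::= \alpha \mid \emptyset \mid E_1+E_2 \mid E_1\cdot E_2 \mid E_1^* \mid (E_1 \,|\, \phi) \mid (\alpha\dashv E_1),\qquad \alpha\in(\Sigma\cup\Gamma)^*.$$ An expression interpretation $I$ interprets each symbol of $\mathcal{F}_k$ as a function $(\Sigma^*)^k\to\Sigma^*$ and each symbol of $\mathcal{P}_k$ as a subset of $(\Sigma^*)^k$,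 in such a way that each letter $a$ denotes the word $a$, $\varepsilon$ denotes the empty word and $\cdot$ denotes catenation; a realization is a map $\mathrm{r}:\Gamma\to\Sigma^*$, extended to a morphism $(\Sigma\cup\Gamma)^*\to\Sigma^*$ that fixes $\Sigma$. The language $L_{I,\mathrm{r}}(E)$ is defined by $L_{I,\mathrm{r}}(\alpha)=\{\mathrm{r}(\alpha)\}$, by the usual clauses for $\emptyset,+,\cdot,{}^*$, by $L_{I,\mathrm{r}}(E_1\,|\,\phi)=L_{I,\mathrm{r}}(E_1)$ if $\phi$ is true under $(I,\mathrm{r})$ and $\emptyset$ otherwise, and by $L_{I,\mathrm{r}}(\alpha\dashv E_1)=\{\mathrm{r}(\alpha)\}\cap L_{I,\mathrm{r}}(E_1)$. Finally $L(E)=\bigcup_{I}\bigcup_{\mathrm{r}}L_{I,\mathrm{r}}(E)$, over all expression interpretations $I$ and all realizations $\mathrm{r}$. Theorem. Let $\mathcal{E}$ be an expression environment whose letters, variables, $k$-ary function symbols and $k$-ary predicate symbols (for each $k$) are numbered injectively by natural numbers, so that every constrained expression $E$ over $\mathcal{E}$ and every word $w\in\Sigma^*$ have Gödel numbers $\ulcorner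 E\urcorner$ and $\ulcorner w\urcorner$. Then, given $E$ and $w$, it is decidable whether $w\in L(E)$: there is a computable function $d:\mathbb{N}\times\mathbb{N}\to\{0,1\}$ such that for every constrained expression $E$ over $\mathcal{E}$ and every word $w\in\Sigma^*$, $$d(\ulcorner E\urcorner,\ulcorner w\urcorner)=1\iff w\in L(E).$$ -/

import Mathlib

universe u v w x

/-- An expression environment `(Σ, Γ, 𝒫, ℱ)`. The families `ℱ` and `𝒫` are the functions and
the relations of the first-order language `lang`; `letter`, `eps` and `conc` witness
`Σ ∪ {ε} ⊆ ℱ₀` and `· ∈ ℱ₂`. -/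
structure ExprEnv where
  /-- the symbol alphabet `Σ` -/
  Sym : Type u
  /-- the variable alphabet `Γ` -/
  Var : Type v
  /-- the function symbols `ℱ` and the predicate symbols `𝒫`, indexed by their arities -/
  lang : FirstOrder.Language.{w, x}
  finite_sym : Finite Sym
  finite_var : Finite Var
  letter : Sym → lang.Functions 0
  eps : lang.Functions 0
  conc : lang.Functions 2
  letter_injective : Function.Injective letter
  letter_ne_eps : ∀ a, letter a ≠ eps

namespace ExprEnv

/-- Boolean formulae over `(𝒫, ℱ(Γ))`: predicate symbols applied to terms, closed under all
boolean operators of all arities (an operator is given by its mapping `{0,1}^k → {0,1}`). -/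
inductive Formula (𝓔 : ExprEnv.{u, v, w, x}) : Type (max v w x)
  | atom {k : ℕ} (P : 𝓔.lang.Relations k) (t : Fin k → 𝓔.lang.Term 𝓔.Var) : Formula 𝓔
  | op {k : ℕ} (o : (Fin k → Bool) → Bool) (φ : Fin k → Formula 𝓔) : Formula 𝓔

/-- Constrained expressions, with the sum as boolean operator. -/
inductive CExpr (𝓔 : ExprEnv.{u, v, w, x}) : Type (max u v w x)
  /-- a word over `Σ ∪ Γ` -/
  | word (α : List (𝓔.Sym ⊕ 𝓔.Var)) : CExpr 𝓔
  /-- `∅` -/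
  | empty : CExpr 𝓔
  /-- `E + F` -/
  | sum (E F : CExpr 𝓔) : CExpr 𝓔
  /-- `E · F` -/
  | cat (E F : CExpr 𝓔) : CExpr 𝓔
  /-- `E*` -/
  | star (E : CExpr 𝓔) : CExpr 𝓔
  /-- `E ∣ φ` -/
  | suchThat (E : CExpr 𝓔) (φ : Formula 𝓔) : CExpr 𝓔
  /-- `α ⊣ E` -/
  | memb (α : List (𝓔.Sym ⊕ 𝓔.Var)) (E : CExpr 𝓔) : CExpr 𝓔

variable {𝓔 : ExprEnv.{u, v, w, x}}

/-- An expression interpretation: an interpretation of `(𝒫, ℱ)` with domain `Σ*` in which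
letters, `ε` and `·` have their intended meaning. -/
structure ExprInterp (𝓔 : ExprEnv.{u, v, w, x}) where
  interp : 𝓔.lang.Structure (List 𝓔.Sym)
  interp_letter : ∀ (a : 𝓔.Sym) (e : Fin 0 → List 𝓔.Sym), interp.funMap (𝓔.letter a) e = [a]
  interp_eps : ∀ e : Fin 0 → List 𝓔.Sym, interp.funMap 𝓔.eps e = []
  interp_conc : ∀ e : Fin 2 → List 𝓔.Sym, interp.funMap 𝓔.conc e = e 0 ++ e 1

/-- The value of a term under an interpretation `I` and a realization `r`. -/
def ExprInterp.termValue (I : ExprInterp 𝓔) (r : 𝓔.Var → List 𝓔.Sym)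
    (t : 𝓔.lang.Term 𝓔.Var) : List 𝓔.Sym :=
  letI := I.interp
  t.realize r

open Classical in
/-- The truth value of a boolean formula under an interpretation `I` and a realization `r`. -/
noncomputable def Formula.eval (I : ExprInterp 𝓔) (r : 𝓔.Var → List 𝓔.Sym) : Formula 𝓔 → Bool
  | .atom P t => decide (I.interp.RelMap P fun i => I.termValue r (t i))
  | .op o φ => o fun i => (φ i).eval I r

/-- The extension of a realization to a morphism from `(Σ ∪ Γ)*` to `Σ*`. -/
def realizeWord (r : 𝓔.Var → List 𝓔.Sym) (α : List (𝓔.Sym ⊕ 𝓔.Var)) : List 𝓔.Sym :=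
  α.flatMap (Sum.elim (fun a => [a]) r)

open Computability in
/-- The `(I, r)`-language denoted by a constrained expression. -/
noncomputable def CExpr.langIR (I : ExprInterp 𝓔) (r : 𝓔.Var → List 𝓔.Sym) :
    CExpr 𝓔 → Language 𝓔.Sym
  | .word α => {realizeWord r α}
  | .empty => 0
  | .sum E F => E.langIR I r + F.langIR I r
  | .cat E F => E.langIR I r * F.langIR I r
  | .star E => (E.langIR I r)∗
  | .suchThat E φ => if φ.eval I r = true then E.langIR I r else 0
  | .memb α E => {u | u = realizeWord r α ∧ u ∈ E.langIR I r}

/-- The `I`-language: the union of the `(I, r)`-languages over all realizations `r`. -/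
def CExpr.langI (I : ExprInterp 𝓔) (E : CExpr 𝓔) : Language 𝓔.Sym :=
  {u | ∃ r : 𝓔.Var → List 𝓔.Sym, u ∈ E.langIR I r}

/-- The language denoted by `E`: the union of the `I`-languages over all interpretations `I`. -/
def CExpr.language (E : CExpr 𝓔) : Language 𝓔.Sym :=
  {u | ∃ I : ExprInterp 𝓔, u ∈ E.langI I}

/-! ### Presenting expressions to an algorithm -/

/-- A numbering of the symbols of an environment: distinct letters (variables, function symbols
of the same arity, predicate symbols of the same arity) get distinct numbers. -/
structure Numbering (𝓔 : ExprEnv.{u, v, w, x}) where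
  sym : 𝓔.Sym ↪ ℕ
  var : 𝓔.Var ↪ ℕ
  fn : ∀ k, 𝓔.lang.Functions k ↪ ℕ
  pred : ∀ k, 𝓔.lang.Relations k ↪ ℕ

/-- Gödel number of a word over `Σ`. -/
def Numbering.codeWord (ν : Numbering 𝓔) (u : List 𝓔.Sym) : ℕ :=
  Encodable.encode (u.map ν.sym)

/-- Gödel number of a word over `Σ ∪ Γ`. -/
def Numbering.codeMixed (ν : Numbering 𝓔) (α : List (𝓔.Sym ⊕ 𝓔.Var)) : ℕ :=
  Encodable.encode (α.map (Sum.map ν.sym ν.var))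

/-- Gödel number of a term. -/
def Numbering.codeTerm (ν : Numbering 𝓔) : 𝓔.lang.Term 𝓔.Var → ℕ
  | .var y => Nat.pair 0 (ν.var y)
  | .func (l := k) f t =>
    Nat.pair 1 (Nat.pair (ν.fn k f) (Encodable.encode (List.ofFn fun i => ν.codeTerm (t i))))

/-- The truth table of a `k`-ary boolean operator: the `j`-th entry, `j < 2 ^ k`, is the value
on the binary digits of `j`. -/
def truthTable {k : ℕ} (o : (Fin k → Bool) → Bool) : List Bool :=
  List.ofFn fun j : Fin (2 ^ k) => o fun i => j.val.testBit i.val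

/-- Gödel number of a boolean formula. -/
def Numbering.codeFormula (ν : Numbering 𝓔) : Formula 𝓔 → ℕ
  | .atom (k := k) P t =>
    Nat.pair 0 (Nat.pair (ν.pred k P) (Encodable.encode (List.ofFn fun i => ν.codeTerm (t i))))
  | .op o φ =>
    Nat.pair 1 (Nat.pair (Encodable.encode (truthTable o))
      (Encodable.encode (List.ofFn fun i => ν.codeFormula (φ i))))

/-- Gödel number of a constrained expression. -/
def Numbering.codeExpr (ν : Numbering 𝓔) : CExpr 𝓔 → ℕ
  | .word α => Nat.pair 0 (ν.codeMixed α)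
  | .empty => Nat.pair 1 0
  | .sum E F => Nat.pair 2 (Nat.pair (ν.codeExpr E) (ν.codeExpr F))
  | .cat E F => Nat.pair 3 (Nat.pair (ν.codeExpr E) (ν.codeExpr F))
  | .star E => Nat.pair 4 (ν.codeExpr E)
  | .suchThat E φ => Nat.pair 5 (Nat.pair (ν.codeExpr E) (ν.codeFormula φ))
  | .memb α E => Nat.pair 6 (Nat.pair (ν.codeMixed α) (ν.codeExpr E))

end ExprEnv

/-! Whether w belongs to the (I, r)-language depends on I and r only through finitely many bits of
information. Every word entering a product equal to w is a subsequence of w. A variable can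
therefore contribute to w only if its value is such a subsequence, and a substitution S guesses
these values; every other variable stays a formal symbol. A star needs at most |w| factors, since
empty ones can be dropped. Finally, formulae depend only on which of the finitely many relevant
atoms hold, and a set T of atoms is guessed.

The difficulty is that a guess must be realized by one interpretation. Evaluating letters, ε and
catenation turns a term into a word over generalized letters: letters, formal variables, and free
function symbols applied to arguments. Arguments are taken modulo a congruence with two properties:
congruent words have equal images under every homomorphism to Σ*, and finitely many incongruent
words are separated by a single homomorphism fixing Σ. By `exists_canon` such a congruence exists
and has primitive recursive normal forms: it is equality if |Σ| ≥ 2, equality of letter counts if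
|Σ| = 1 (where Σ* is commutative), and trivial if Σ is empty.

For soundness (`mem_language_of_mem_lang`), a separating homomorphism makes the values of the
relevant terms collide only when their normal forms are congruent, so free symbols and predicates
can be interpreted consistently with S and any T. For completeness (`exists_mem_lang`), S and T are
read off from I and r. The search over S and T is primitive recursive on Gödel numbers, because
parts of an object have smaller numbers. -/

/-! ### Primitive recursive functions on lists -/

namespace Primrec

variable {α σ : Type*} [Primcodable α] [Primcodable σ]

/-- A function on `ℕ` that is constant from some point on is primitive recursive. -/
theorem of_eventually_const {f : ℕ → σ} (N : ℕ) (d : σ) (h : ∀ n, N ≤ n → f n = d) :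
    Primrec f := by
  refine ((list_getD d).comp (const ((List.range N).map f)) Primrec.id).of_eq fun n => ?_
  by_cases hn : n < N
  · simp [List.getD, hn]
  · simp [List.getD, hn, h n (not_lt.1 hn)]

end Primrec

/-! ### Course-of-values recursion -/

section CourseOfValues

variable {α σ : Type*}

/-- The list of the first `n` values of the function defined by course-of-values recursion
with step function `G`. -/
def covTable (G : α → ℕ → List σ → σ) (a : α) (n : ℕ) : List σ :=
  n.rec [] fun m l => l ++ [G a m l]

/-- Course-of-values recursion with step function `G`. -/
def covRec (G : α → ℕ → List σ → σ) (a : α) (n : ℕ) : σ :=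
  G a n (covTable G a n)

theorem covTable_eq (G : α → ℕ → List σ → σ) (a : α) (n : ℕ) :
    covTable G a n = (List.range n).map (covRec G a) := by
  induction n with
  | zero => rfl
  | succ n ih =>
    rw [List.range_succ, List.map_append, ← ih]
    rfl

theorem covTable_getD (G : α → ℕ → List σ → σ) (a : α) {m n : ℕ} (h : m < n) (d : σ) :
    (covTable G a n).getD m d = covRec G a m := by
  simp [covTable_eq, List.getD, h]

/-- The table of earlier values grows by ordinary primitive recursion, and one more application of
the step function gives the value. -/
theorem Primrec.covRec [Primcodable α] [Primcodable σ] {G : α → ℕ → List σ → σ}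
    (hG : Primrec fun p : (α × ℕ) × List σ => G p.1.1 p.1.2 p.2) :
    Primrec fun p : α × ℕ => _root_.covRec G p.1 p.2 := by
  have h : Primrec fun p : α × ℕ => covTable G p.1 p.2 :=
    nat_rec' snd (const []) (list_concat.comp₂ (snd.comp snd).to₂
      (hG.comp (pair (pair (fst.comp fst) (fst.comp snd)) (snd.comp snd))).to₂)
  exact hG.comp (pair Primrec.id h)

end CourseOfValues

/-! ### Subsequences, sections and products of lists -/

namespace Primrec

variable {α β σ : Type*} [Primcodable α] [Primcodable β] [Primcodable σ]

theorem list_getD_map {ih : α → List σ} {l : α → List ℕ} (hih : Primrec ih) (hl : Primrec l)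
    (d : σ) : Primrec fun a => (l a).map fun m => (ih a).getD m d :=
  list_map hl ((list_getD d).comp (hih.comp fst) snd).to₂

theorem list_sublists' : Primrec (List.sublists' : List α → List (List α)) := by
  refine (list_foldr (h := fun _ p => p.2 ++ p.2.map (p.1 :: ·)) Primrec.id (const [[]])
    (list_append.comp (snd.comp snd) (list_map (snd.comp snd)
      (list_cons.comp (fst.comp (snd.comp fst)) snd).to₂)).to₂).of_eq fun l => ?_
  induction l with
  | nil => rfl
  | cons a l ih => rw [List.sublists'_cons, ← ih]; rfl

theorem list_sections : Primrec (List.sections : List (List α) → List (List α)) := by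
  refine (list_foldr (h := fun _ p => p.2.flatMap fun s => p.1.map (· :: s)) Primrec.id
    (const [[]]) (list_flatMap (snd.comp snd) (list_map (fst.comp (snd.comp fst))
      (list_cons.comp snd (snd.comp fst)).to₂).to₂).to₂).of_eq fun l => ?_
  induction l with
  | nil => rfl
  | cons a l ih => simp only [List.sections, ← ih]; rfl

/-- Elementwise concatenation of two lists of words. -/
theorem list_catProduct {f g : β → List (List α)} (hf : Primrec f) (hg : Primrec g) :
    Primrec fun b => (f b).flatMap fun x => (g b).map (x ++ ·) :=
  list_flatMap hf (list_map (hg.comp fst) (list_append.comp (snd.comp fst) snd).to₂).to₂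

theorem decide_mem {f : β → α} {g : β → List α} [∀ b, Decidable (f b ∈ g b)]
    (hf : Primrec f) (hg : Primrec g) : Primrec fun b => decide (f b ∈ g b) := by
  classical
  refine (nat_lt.decide.comp (list_idxOf.comp hf hg) (list_length.comp hg)).of_eq fun b => ?_
  simp [List.idxOf_lt_length_iff]

theorem list_count_apply [DecidableEq α] {f : β → α} {g : β → List α} (hf : Primrec f)
    (hg : Primrec g) : Primrec fun b => (g b).count (f b) := by
  refine (list_foldr (h := fun b p => if p.1 = f b then p.2 + 1 else p.2) hg (const 0)
    (ite (Primrec.eq.comp (fst.comp snd) (hf.comp fst))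
      (succ.comp (snd.comp snd)) (snd.comp snd)).to₂).of_eq fun b => ?_
  induction g b with
  | nil => rfl
  | cons a l ih => simp only [List.foldr_cons, ih, List.count_cons, beq_iff_eq]; split <;> rfl

end Primrec

/-- This makes argument lists accessible to course-of-values recursion: the entries of a coded list
lie within the table of earlier values. -/
theorem Encodable.lt_encode_of_mem {m : ℕ} {l : List ℕ} (h : m ∈ l) : m < encode l := by
  induction l with
  | nil => simp at h
  | cons a l ih =>
    rw [encode_list_cons, Nat.lt_succ_iff, encode_nat]
    rcases List.mem_cons.1 h with rfl | h
    · exact Nat.left_le_pair _ _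
    · exact (ih h).le.trans (Nat.right_le_pair _ _)

/-! ### The decision procedure on codes -/

open Encodable

/-- The data about an environment that the decision procedure needs. Words over generalized
letters (letters, variables, applied function symbols) are lists of natural numbers; `canon`
numbers such words up to a congruence, `constNF` gives the values of the interpreted constants,
and `conc` is the number of the catenation symbol. -/
structure NFData where
  canon : List ℕ → ℕ
  constNF : ℕ → Option (List ℕ)
  conc : ℕ
  primrec_canon : Primrec canon
  primrec_constNF : Primrec constNF

namespace NFData

variable (D : NFData)

/-- The generalized letter for the function symbol number `f` applied to `args`. -/
def gen (f : ℕ) (args : List (List ℕ)) : ℕ :=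
  Nat.pair 2 (Nat.pair f (encode (args.map D.canon)))

/-- The normal form of the function symbol number `f` applied to `args`. -/
def app (f : ℕ) (args : List (List ℕ)) : List ℕ :=
  if args.length = 0 then (D.constNF f).getD [D.gen f args]
  else if args.length = 2 ∧ f = D.conc then args.flatten else [D.gen f args]

/-- The step function of `nf`. -/
def nfStep (S : List (List ℕ)) (n : ℕ) (ih : List (List ℕ)) : List ℕ :=
  if n.unpair.1 = 0 then S.getD n.unpair.2 []
  else D.app n.unpair.2.unpair.1
    ((Denumerable.ofNat (List ℕ) n.unpair.2.unpair.2).map fun m => ih.getD m [])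

/-- The normal form of the term with number `n` under the substitution `S`. -/
def nf : List (List ℕ) → ℕ → List ℕ := covRec D.nfStep

/-- The normal form of the atom with number `n` under the substitution `S`. -/
def atomNF (S : List (List ℕ)) (n : ℕ) : ℕ :=
  Nat.pair n.unpair.2.unpair.1
    (encode ((Denumerable.ofNat (List ℕ) n.unpair.2.unpair.2).map fun m => D.canon (D.nf S m)))

/-- The number with binary digits `l`, least significant first. -/
def ofBitList (l : List Bool) : ℕ := l.foldr (fun b n => 2 * n + b.toNat) 0

/-- The step function of `holds`. -/
def holdsStep (p : List (List ℕ) × List ℕ) (n : ℕ) (ih : List Bool) : Bool :=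
  if n.unpair.1 = 0 then decide (D.atomNF p.1 n ∈ p.2)
  else ((decode (α := List Bool) n.unpair.2.unpair.1).getD []).getD
    (ofBitList ((Denumerable.ofNat (List ℕ) n.unpair.2.unpair.2).map fun m => ih.getD m false))
    false

/-- The truth value of the formula with number `n` when exactly the atoms with normal form
in `p.2` are true. -/
def holds : List (List ℕ) × List ℕ → ℕ → Bool := covRec D.holdsStep

/-- The substitution `S` applied to the word over letters and variables with number `n`. -/
def substWord (S : List (List ℕ)) (n : ℕ) : List ℕ :=
  ((decode (α := List (ℕ ⊕ ℕ)) n).getD []).flatMap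
    (Sum.elim (fun a => [Nat.pair 0 a]) fun y => S.getD y [])

/-- Products of at most `k` elements of `l`, as words. -/
def powers (k : ℕ) (l : List (List ℕ)) : List (List ℕ) :=
  (fun X => [] :: X.flatMap fun x => l.map (x ++ ·))^[k] [[]]

/-- The step function of `lang`. -/
def langStep (p : (List (List ℕ) × List ℕ) × ℕ) (n : ℕ) (ih : List (List (List ℕ))) :
    List (List ℕ) :=
  if n.unpair.1 = 0 then [substWord p.1.1 n.unpair.2]
  else if n.unpair.1 = 1 then []
  else if n.unpair.1 = 2 then
    ih.getD n.unpair.2.unpair.1 [] ++ ih.getD n.unpair.2.unpair.2 []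
  else if n.unpair.1 = 3 then
    (ih.getD n.unpair.2.unpair.1 []).flatMap fun x =>
      (ih.getD n.unpair.2.unpair.2 []).map (x ++ ·)
  else if n.unpair.1 = 4 then powers p.2 (ih.getD n.unpair.2 [])
  else if n.unpair.1 = 5 then
    if D.holds p.1 n.unpair.2.unpair.2 = true then ih.getD n.unpair.2.unpair.1 [] else []
  else if substWord p.1.1 n.unpair.2.unpair.1 ∈ ih.getD n.unpair.2.unpair.2 [] then
    [substWord p.1.1 n.unpair.2.unpair.1] else []

/-- A finite part of the language of the expression with number `n`. -/
def lang : (List (List ℕ) × List ℕ) × ℕ → ℕ → List (List ℕ) := covRec D.langStep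

/-- The substitutions, for the variables with number less than `V`, of variables by themselves
or by subsequences of `l`. -/
def substs (V : ℕ) (l : List ℕ) : List (List (List ℕ)) :=
  List.sections ((List.range V).map fun y => [Nat.pair 1 y] :: l.sublists')

/-- The candidates for the set of normal forms of true atoms with number less than `e`. -/
def truths (S : List (List ℕ)) (e : ℕ) : List (List ℕ) :=
  List.sublists' ((List.range e).map (D.atomNF S))

/-- The word with number `n`, as a word over generalized letters. -/
def inputWord (n : ℕ) : List ℕ := (Denumerable.ofNat (List ℕ) n).map (Nat.pair 0)

/-- Does the language of the expression with number `p.1` contain the word with number `p.2`? -/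
def decideMem (V : ℕ) (p : ℕ × ℕ) : Bool :=
  decide (inputWord p.2 ∈ (substs V (inputWord p.2)).flatMap fun S =>
    (D.truths S p.1).flatMap fun T => D.lang ((S, T), (inputWord p.2).length) p.1)

/-! ### Primitive recursiveness of the decision procedure -/

section Primrec

open Primrec

theorem primrec_gen : Primrec fun p : ℕ × List (List ℕ) => D.gen p.1 p.2 :=
  Primrec₂.natPair.comp (const 2) (Primrec₂.natPair.comp fst
    (Primrec.encode.comp (list_map snd (D.primrec_canon.comp snd).to₂)))

theorem primrec_app : Primrec fun p : ℕ × List (List ℕ) => D.app p.1 p.2 := by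
  have hg : Primrec fun p : ℕ × List (List ℕ) => [D.gen p.1 p.2] :=
    list_cons.comp D.primrec_gen (const [])
  have hl : Primrec fun p : ℕ × List (List ℕ) => p.2.length := list_length.comp snd
  exact ite (Primrec.eq.comp hl (const 0)) (option_getD.comp (D.primrec_constNF.comp fst) hg)
    (ite ((Primrec.eq.comp hl (const 2)).and (Primrec.eq.comp fst (const D.conc)))
      (list_flatten.comp snd) hg)

variable {α : Type*} [Primcodable α]

theorem primrec_unpair_fst {f : α → ℕ} (hf : Primrec f) : Primrec fun a => (f a).unpair.1 :=
  fst.comp (unpair.comp hf)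

theorem primrec_unpair_snd {f : α → ℕ} (hf : Primrec f) : Primrec fun a => (f a).unpair.2 :=
  snd.comp (unpair.comp hf)

theorem primrec_nf : Primrec fun p : List (List ℕ) × ℕ => D.nf p.1 p.2 := by
  refine Primrec.covRec ?_
  have hn : Primrec fun p : (List (List ℕ) × ℕ) × List (List ℕ) => p.1.2 := snd.comp fst
  have h2 := primrec_unpair_snd hn
  exact ite (Primrec.eq.comp (primrec_unpair_fst hn) (const 0))
    ((list_getD []).comp (fst.comp fst) h2)
    (D.primrec_app.comp (pair (primrec_unpair_fst h2)
      (list_getD_map snd ((Primrec.ofNat (List ℕ)).comp (primrec_unpair_snd h2)) [])))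

theorem primrec_atomNF : Primrec fun p : List (List ℕ) × ℕ => D.atomNF p.1 p.2 := by
  have h2 := primrec_unpair_snd (snd (α := List (List ℕ)) (β := ℕ))
  exact Primrec₂.natPair.comp (primrec_unpair_fst h2) (Primrec.encode.comp
    (list_map ((Primrec.ofNat (List ℕ)).comp (primrec_unpair_snd h2))
      (D.primrec_canon.comp (D.primrec_nf.comp (pair (fst.comp fst) snd))).to₂))

theorem primrec_ofBitList : Primrec ofBitList :=
  list_foldr Primrec.id (const 0)
    (nat_add.comp (nat_mul.comp (const 2) (snd.comp snd))
      ((dom_bool Bool.toNat).comp (fst.comp snd))).to₂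

theorem primrec_holds :
    Primrec fun p : (List (List ℕ) × List ℕ) × ℕ => D.holds p.1 p.2 := by
  refine Primrec.covRec (G := D.holdsStep) ?_
  have hn : Primrec fun p : ((List (List ℕ) × List ℕ) × ℕ) × List Bool => p.1.2 :=
    snd.comp fst
  have h2 := primrec_unpair_snd hn
  have hp := pair (fst.comp (fst.comp fst)) hn
  have ha := D.primrec_atomNF.comp hp
  exact ite (Primrec.eq.comp (primrec_unpair_fst hn) (const 0))
    (decide_mem ha (snd.comp (fst.comp fst)))
    ((list_getD false).comp
      (option_getD.comp (Primrec.decode.comp (primrec_unpair_fst h2)) (const []))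
      (primrec_ofBitList.comp
        (list_getD_map snd ((Primrec.ofNat (List ℕ)).comp (primrec_unpair_snd h2)) false)))

theorem primrec_substWord : Primrec fun p : List (List ℕ) × ℕ => substWord p.1 p.2 := by
  refine (list_flatMap (g := fun p s => Sum.casesOn s (fun a => [Nat.pair 0 a])
      fun y => p.1.getD y [])
    (option_getD.comp (Primrec.decode.comp snd) (const []))
    (sumCasesOn snd
      (list_cons.comp (Primrec₂.natPair.comp (const 0) snd) (const [])).to₂
      ((list_getD []).comp (fst.comp (fst.comp fst)) snd).to₂).to₂).of_eq fun p => ?_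
  unfold substWord
  congr 1

theorem primrec_powers : Primrec fun p : ℕ × List (List ℕ) => powers p.1 p.2 :=
  nat_iterate fst (const [[]])
    (list_cons.comp (const []) (list_catProduct snd (snd.comp fst))).to₂

theorem primrec_lang :
    Primrec fun p : ((List (List ℕ) × List ℕ) × ℕ) × ℕ => D.lang p.1 p.2 := by
  refine Primrec.covRec (G := D.langStep) ?_
  have hn : Primrec fun p : (((List (List ℕ) × List ℕ) × ℕ) × ℕ) × List (List (List ℕ)) =>
    p.1.2 := snd.comp fst
  have h1 := primrec_unpair_fst hn
  have h2 := primrec_unpair_snd hn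
  have hl := primrec_unpair_fst h2
  have hr := primrec_unpair_snd h2
  have hp : Primrec fun p : (((List (List ℕ) × List ℕ) × ℕ) × ℕ) × List (List (List ℕ)) =>
    p.1.1.1 := fst.comp (fst.comp fst)
  have ih {f : _ → ℕ} (hf : Primrec f) :
      Primrec fun p : (((List (List ℕ) × List ℕ) × ℕ) × ℕ) × List (List (List ℕ)) =>
        p.2.getD (f p) [] := (list_getD []).comp snd hf
  have hs {f : _ → ℕ} (hf : Primrec f) :
      Primrec fun p : (((List (List ℕ) × List ℕ) × ℕ) × ℕ) × List (List (List ℕ)) =>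
        substWord p.1.1.1.1 (f p) := by
    have h := pair (fst.comp hp) hf
    have h' := primrec_substWord.comp h
    exact h'
  have hc (c : ℕ) := Primrec.eq.comp h1 (const c)
  have hpr := pair hp hr
  have hpk := pair (snd.comp (fst.comp fst)) (ih h2)
  have hpow := primrec_powers.comp hpk
  have hφ := D.primrec_holds.comp hpr
  exact ite (hc 0) (list_cons.comp (hs h2) (const []))
    (ite (hc 1) (const [])
    (ite (hc 2) (list_append.comp (ih hl) (ih hr))
    (ite (hc 3) (list_catProduct (ih hl) (ih hr))
    (ite (hc 4) hpow
    (ite (hc 5)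
      (ite (Primrec.eq.comp hφ (const true)) (ih hl) (const []))
    (ite (Primrec.primrecPred (decide_mem (hs hl) (ih hr)))
      (list_cons.comp (hs hl) (const [])) (const [])))))))

theorem primrec_decideMem (V : ℕ) : Primrec (D.decideMem V) := by
  have hw : Primrec fun p : ℕ × ℕ => inputWord p.2 :=
    list_map ((Primrec.ofNat (List ℕ)).comp snd) (Primrec₂.natPair.comp (const 0) snd).to₂
  refine decide_mem hw (list_flatMap (list_sections.comp (list_map (const (List.range V))
    (list_cons.comp (list_cons.comp (Primrec₂.natPair.comp (const 1) snd) (const []))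
      (list_sublists'.comp (hw.comp fst))).to₂)) (list_flatMap (list_sublists'.comp (list_map
        (list_range.comp (fst.comp fst)) (D.primrec_atomNF.comp (pair (snd.comp fst) snd)).to₂))
      (D.primrec_lang.comp (pair (pair (pair (snd.comp fst) snd)
        (list_length.comp (hw.comp (fst.comp fst)))) (fst.comp (fst.comp fst)))).to₂).to₂)

end Primrec

end NFData

/-! ### Separating words over generalized letters by words over the alphabet -/

section Separation

variable {A : Type*}

/-- The first `a` marks the end of the run of `b`, so the exponent can be read off. -/
theorem replicate_append_cons_inj {a b : A} (hab : a ≠ b) {p q : ℕ} {s t : List A}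
    (h : List.replicate p b ++ a :: s = List.replicate q b ++ a :: t) : p = q ∧ s = t := by
  induction p generalizing q with
  | zero =>
    cases q with
    | zero => simpa using h
    | succ q => simp [List.replicate_succ, hab] at h
  | succ p ih =>
    cases q with
    | zero => simp [List.replicate_succ, hab.symm] at h
    | succ q =>
      simp only [List.replicate_succ, List.cons_append, List.cons.injEq, true_and] at h
      simpa using ih h

open Classical in
/-- Letters are sent to themselves, every other number `n` to `a ^ N * b ^ (n + 1) * a`. -/
noncomputable def blockCode (c : A ↪ ℕ) (a b : A) (N n : ℕ) : List A :=
  if h : ∃ x, c x = n then [h.choose]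
  else List.replicate N a ++ (List.replicate (n + 1) b ++ [a])

theorem blockCode_apply (c : A ↪ ℕ) (a b : A) (N : ℕ) (x : A) :
    blockCode c a b N (c x) = [x] := by
  have h : ∃ y, c y = c x := ⟨x, rfl⟩
  rw [blockCode, dif_pos h, c.injective h.choose_spec]

theorem blockCode_of_forall_ne {c : A ↪ ℕ} {n : ℕ} (h : ∀ x, c x ≠ n) (a b : A) (N : ℕ) :
    blockCode c a b N n = List.replicate N a ++ (List.replicate (n + 1) b ++ [a]) := by
  rw [blockCode, dif_neg]
  rintro ⟨x, hx⟩
  exact h x hx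

/-- A run of `a` that began with at least one single letter cannot stop exactly at position `N`.
With single letters only, the word has length at most `N`. If a block follows, its own `N` copies of
`a` carry the run past position `N`. -/
theorem flatMap_blockCode_not_block (c : A ↪ ℕ) {a b : A} (hab : a ≠ b) (N : ℕ) (l : List ℕ)
    (k : ℕ) (hk : 1 ≤ k) (hl : k + l.length ≤ N)
    (h : ∀ j < N, (List.replicate k a ++ l.flatMap (blockCode c a b N))[j]? = some a) :
    (List.replicate k a ++ l.flatMap (blockCode c a b N))[N]? ≠ some b := by
  induction l generalizing k with
  | nil =>
    have hk' : k ≤ N := by simpa using hl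
    simp [hk'.not_gt]
  | cons n l ih =>
    rw [List.length_cons] at hl
    rw [List.flatMap_cons] at h ⊢
    by_cases hn : ∃ x, c x = n
    · obtain ⟨x, rfl⟩ := hn
      rw [blockCode_apply] at h ⊢
      have hx : x = a := by
        have := h k (by omega)
        simpa [List.getElem?_append_right] using this
      subst hx
      have e : List.replicate k x ++ ([x] ++ l.flatMap (blockCode c x b N)) =
          List.replicate (k + 1) x ++ l.flatMap (blockCode c x b N) := by
        rw [List.replicate_succ', List.append_assoc]
      rw [e] at h ⊢
      exact ih (k + 1) (by omega) (by omega) h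
    -- The block starts at position `k`, and `1 ≤ k` puts position `N` inside its initial run of
    -- `a`.
    · rw [blockCode_of_forall_ne (not_exists.1 hn), List.append_assoc,
        List.getElem?_append_right (by simp; omega),
        List.getElem?_append_left (by simp; omega)]
      simp only [List.length_replicate, List.getElem?_replicate]
      rw [if_pos (by omega)]
      simpa using hab

theorem letter_append_ne_block_append (c : A ↪ ℕ) {a b : A} (hab : a ≠ b) (N : ℕ) (x : A)
    (l : List ℕ) (n : ℕ) (s : List A) (hl : l.length < N) :
    [x] ++ l.flatMap (blockCode c a b N) ≠
      List.replicate N a ++ (List.replicate (n + 1) b ++ [a]) ++ s := by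
  intro h
  have hx : x = a := by
    obtain ⟨N, rfl⟩ : ∃ M, N = M + 1 := ⟨N - 1, by omega⟩
    simpa [List.replicate_succ] using congrArg List.head? h
  subst hx
  have e : [x] ++ l.flatMap (blockCode c x b N) =
    List.replicate 1 x ++ l.flatMap (blockCode c x b N) := rfl
  rw [e] at h
  refine flatMap_blockCode_not_block c hab N l 1 le_rfl (by omega) ?_ ?_
  · intro j hj
    rw [h, List.append_assoc, List.getElem?_append_left (by simpa), List.getElem?_replicate,
      if_pos hj]
  · rw [h, List.append_assoc, List.getElem?_append_right (by simp)]
    simp [List.replicate_succ]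

theorem blockCode_ne_nil (c : A ↪ ℕ) (a b : A) (N n : ℕ) : blockCode c a b N n ≠ [] := by
  unfold blockCode
  split <;> simp

/-- Decoding proceeds from the left: the length bounds rule out confusing a letter with a block, and
two initial blocks are compared through their runs of `b`. -/
theorem flatMap_blockCode_inj (c : A ↪ ℕ) {a b : A} (hab : a ≠ b) (N : ℕ) {l m : List ℕ}
    (hl : l.length ≤ N) (hm : m.length ≤ N)
    (h : l.flatMap (blockCode c a b N) = m.flatMap (blockCode c a b N)) : l = m := by
  induction l generalizing m with
  | nil =>
    cases m with
    | nil => rfl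
    | cons y m => simp [blockCode_ne_nil] at h
  | cons x l ih =>
    cases m with
    | nil => simp [blockCode_ne_nil] at h
    | cons y m =>
      rw [List.length_cons] at hl hm
      rw [List.flatMap_cons, List.flatMap_cons] at h
      by_cases hx : ∃ z, c z = x <;> by_cases hy : ∃ z, c z = y
      · obtain ⟨x, rfl⟩ := hx
        obtain ⟨y, rfl⟩ := hy
        rw [blockCode_apply, blockCode_apply] at h
        simp only [List.cons_append, List.nil_append, List.cons.injEq] at h
        rw [h.1, ih (by omega) (by omega) h.2]
      · obtain ⟨x, rfl⟩ := hx
        rw [blockCode_apply, blockCode_of_forall_ne (not_exists.1 hy)] at h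
        exact (letter_append_ne_block_append c hab N x l y _ (by omega) h).elim
      · obtain ⟨y, rfl⟩ := hy
        rw [blockCode_apply, blockCode_of_forall_ne (not_exists.1 hx)] at h
        exact (letter_append_ne_block_append c hab N y m x _ (by omega) h.symm).elim
      · rw [blockCode_of_forall_ne (not_exists.1 hy), blockCode_of_forall_ne (not_exists.1 hx),
          List.append_assoc, List.append_assoc, List.append_assoc, List.append_assoc,
          List.append_cancel_left_eq] at h
        obtain ⟨hxy, hs⟩ := replicate_append_cons_inj hab h
        rw [Nat.succ.inj hxy, ih (by omega) (by omega) hs]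

/-- The polynomial whose coefficients count the occurrences of the elements of a list. -/
noncomputable def countPoly (e : ℕ → ℕ) (l : List ℕ) : Polynomial ℤ :=
  (l.map fun n => (Polynomial.X : Polynomial ℤ) ^ e n).sum

theorem coeff_countPoly {e : ℕ → ℕ} (he : Function.Injective e) (l : List ℕ) (n : ℕ) :
    (countPoly e l).coeff (e n) = l.count n := by
  unfold countPoly
  induction l with
  | nil => simp
  | cons m l ih =>
    rw [List.map_cons, List.sum_cons, Polynomial.coeff_add, ih, Polynomial.coeff_X_pow,
      List.count_cons]
    by_cases h : m = n
    · subst h; simp [add_comm]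
    · simp [h, he.ne (Ne.symm h)]

theorem eval_countPoly (e : ℕ → ℕ) (l : List ℕ) (B : ℕ) :
    (countPoly e l).eval (B : ℤ) = ((l.map fun n => B ^ e n).sum : ℕ) := by
  unfold countPoly
  induction l with
  | nil => simp
  | cons m l ih => simp [ih]

/-- Distinct counting polynomials agree at only finitely many integers, and `F` gives finitely many
pairs. Any `B` outside these coincidences works, since the coefficients recover the multiplicities.
-/
theorem exists_separating_base {e : ℕ → ℕ} (he : Function.Injective e) {F : Set (List ℕ)}
    (hF : F.Finite) : ∃ B : ℕ, ∀ l ∈ F, ∀ m ∈ F,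
      (l.map fun n => B ^ e n).sum = (m.map fun n => B ^ e n).sum → l.Perm m := by
  have hfin : (⋃ p ∈ F ×ˢ F, {B : ℕ | countPoly e p.1 ≠ countPoly e p.2 ∧
      (countPoly e p.1).eval (B : ℤ) = (countPoly e p.2).eval (B : ℤ)}).Finite := by
    refine (hF.prod hF).biUnion fun p _ => ?_
    by_cases hp : countPoly e p.1 = countPoly e p.2
    · simp [hp]
    · refine (((countPoly e p.1 - countPoly e p.2).roots.toFinset.finite_toSet).preimage
        (f := ((↑) : ℕ → ℤ)) Nat.cast_injective.injOn).subset fun B hB => ?_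
      simp [sub_eq_zero, hp, hB.2]
  obtain ⟨B, hB⟩ := hfin.infinite_compl.nonempty
  refine ⟨B, fun l hl m hm h => ?_⟩
  have hp : countPoly e l = countPoly e m := by
    by_contra hne
    refine hB (Set.mem_biUnion (Set.mk_mem_prod hl hm) ⟨hne, ?_⟩)
    simp only [eval_countPoly, h]
  rw [List.perm_iff_count]
  intro n
  have := congrArg (fun p => Polynomial.coeff p (e n)) hp
  simpa [coeff_countPoly he] using this

/-- A numbering of the lists of natural numbers up to permutation. -/
def countCode (l : List ℕ) : ℕ :=
  Encodable.encode ((List.range (l.sum + 1)).map fun n => l.count n)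

/-- The length of the coded list reveals the sum, and every element is at most the sum, so no
multiplicity is lost by truncation. -/
theorem countCode_eq_iff {l m : List ℕ} : countCode l = countCode m ↔ l.Perm m := by
  constructor
  · intro h
    have h := Encodable.encode_injective h
    have hs : l.sum = m.sum := by simpa using congrArg List.length h
    rw [hs] at h
    rw [List.perm_iff_count]
    intro n
    by_cases hn : n ≤ m.sum
    · have := congrArg (fun k : List ℕ => k[n]?) h
      simpa [Nat.lt_succ_of_le hn] using this
    · rw [List.count_eq_zero.2, List.count_eq_zero.2]
      · exact fun h => hn (List.single_le_sum (fun _ _ => Nat.zero_le _) _ h)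
      · exact fun h => hn (hs ▸ List.single_le_sum (fun _ _ => Nat.zero_le _) _ h)
  · intro h
    unfold countCode
    rw [h.sum_eq]
    simp only [h.count_eq]

theorem primrec_countCode : Primrec countCode := by
  have hs : Primrec (List.sum : List ℕ → ℕ) :=
    Primrec.list_foldr Primrec.id (Primrec.const 0)
      (Primrec.nat_add.comp (Primrec.fst.comp Primrec.snd) (Primrec.snd.comp Primrec.snd)).to₂
  exact Primrec.encode.comp (Primrec.list_map (Primrec.list_range.comp (Primrec.succ.comp hs))
    (Primrec.list_count_apply Primrec.snd Primrec.fst).to₂)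

/-- Words of generalized letters have a primitive recursive normal form for the congruence that
holds under all homomorphisms to `A*`, and finitely many words can be separated up to this
congruence by one homomorphism that fixes the letters. -/
theorem exists_canon (c : A ↪ ℕ) : ∃ κ : List ℕ → ℕ, Primrec κ ∧
    (∀ (g : ℕ → List A) (l m : List ℕ), κ l = κ m → l.flatMap g = m.flatMap g) ∧
    ∀ F : Set (List ℕ), F.Finite → ∃ g : ℕ → List A, (∀ a, g (c a) = [a]) ∧
      ∀ l ∈ F, ∀ m ∈ F, l.flatMap g = m.flatMap g → κ l = κ m := by
  rcases isEmpty_or_nonempty A with hA | ⟨⟨a⟩⟩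
  · exact ⟨fun _ => 0, Primrec.const 0, fun _ _ _ _ => Subsingleton.elim _ _,
      fun _ _ => ⟨fun _ => [], fun a => hA.elim a, fun _ _ _ _ _ => rfl⟩⟩
  rcases subsingleton_or_nontrivial A with hA | hA
  · have hrep (s : List A) : s = List.replicate s.length a :=
      List.eq_replicate_of_mem fun _ _ => Subsingleton.elim _ _
    refine ⟨countCode, primrec_countCode, fun g l m h => ?_, fun F hF => ?_⟩
    · rw [hrep (l.flatMap g), hrep (m.flatMap g),
        ((countCode_eq_iff.1 h).flatMap_right g).length_eq]
    · obtain ⟨B, hB⟩ := exists_separating_base (Equiv.swap (c a) 0).injective hF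
      -- The swap gives the only letter exponent 0, so that its image has length `B ^ 0 = 1` and the
      -- letter is fixed.
      refine ⟨fun n => List.replicate (B ^ (Equiv.swap (c a) 0) n) a, fun x => ?_,
        fun l hl m hm h => countCode_eq_iff.2 (hB l hl m hm ?_)⟩
      · rw [Subsingleton.elim x a]; simp
      · simpa [List.length_flatMap] using congrArg List.length h
  · obtain ⟨b, hb⟩ := exists_ne a
    refine ⟨Encodable.encode, Primrec.encode, fun g l m h => ?_, fun F hF => ?_⟩
    · rw [Encodable.encode_injective h]
    · obtain ⟨N, hN⟩ := (hF.image List.length).bddAbove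
      refine ⟨blockCode c a b N, blockCode_apply c a b N, fun l hl m hm h => ?_⟩
      rw [flatMap_blockCode_inj c hb.symm N (hN ⟨l, hl, rfl⟩) (hN ⟨m, hm, rfl⟩) h]

end Separation

namespace NFData

variable (D : NFData)

/-! ### The values of the recursive functions on codes -/

theorem gen_inj {f f' : ℕ} {l l' : List (List ℕ)} (h : D.gen f l = D.gen f' l') :
    f = f' ∧ l.map D.canon = l'.map D.canon := by
  have h := (Nat.pair_eq_pair.1 (Nat.pair_eq_pair.1 h).2)
  exact ⟨h.1, encode_injective h.2⟩

theorem nf_pair_zero (S : List (List ℕ)) (y : ℕ) : D.nf S (Nat.pair 0 y) = S.getD y [] := by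
  simp [nf, covRec, nfStep]

theorem nf_pair_one (S : List (List ℕ)) (f : ℕ) (l : List ℕ) :
    D.nf S (Nat.pair 1 (Nat.pair f (encode l))) = D.app f (l.map (D.nf S)) := by
  have h : ∀ m ∈ l, (covTable D.nfStep S (Nat.pair 1 (Nat.pair f (encode l)))).getD m [] =
      D.nf S m := fun m hm => covTable_getD _ _ ((lt_encode_of_mem hm).trans_le
        ((Nat.right_le_pair _ _).trans (Nat.right_le_pair _ _))) _
  rw [nf, covRec, nfStep]
  simp only [Nat.unpair_pair, one_ne_zero, if_false]
  rw [Denumerable.ofNat_encode, List.map_congr_left h]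
  rfl

theorem atomNF_pair (S : List (List ℕ)) (P : ℕ) (l : List ℕ) :
    D.atomNF S (Nat.pair 0 (Nat.pair P (encode l))) =
      Nat.pair P (encode (l.map fun m => D.canon (D.nf S m))) := by
  rw [atomNF]
  simp only [Nat.unpair_pair]
  rw [Denumerable.ofNat_encode]

theorem holds_pair_zero (S : List (List ℕ)) (T : List ℕ) (n : ℕ) :
    D.holds (S, T) (Nat.pair 0 n) = decide (D.atomNF S (Nat.pair 0 n) ∈ T) := by
  rw [holds, covRec, holdsStep]
  simp only [Nat.unpair_pair, if_true]

theorem holds_pair_one (p : List (List ℕ) × List ℕ) (t l : List _) :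
    D.holds p (Nat.pair 1 (Nat.pair (encode t) (encode l))) =
      t.getD (ofBitList (l.map (D.holds p))) false := by
  have h : ∀ m ∈ l, (covTable D.holdsStep p (Nat.pair 1 (Nat.pair (encode t)
      (encode l)))).getD m false = D.holds p m := fun m hm => covTable_getD _ _
        ((lt_encode_of_mem hm).trans_le ((Nat.right_le_pair _ _).trans (Nat.right_le_pair _ _))) _
  rw [holds, covRec, holdsStep]
  simp only [Nat.unpair_pair, one_ne_zero, if_false]
  rw [Denumerable.ofNat_encode, List.map_congr_left h, encodek]
  rfl

theorem ofBitList_ofFn {k : ℕ} (b : Fin k → Bool) : ofBitList (List.ofFn b) = Nat.ofBits b := by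
  induction k with
  | zero => simp [ofBitList]
  | succ k ih =>
    rw [List.ofFn_succ, Nat.ofBits_succ, ofBitList, List.foldr_cons, ← ofBitList, ih]
    rfl

theorem truthTable_getD_ofBitList {k : ℕ} (o : (Fin k → Bool) → Bool) (b : Fin k → Bool) :
    (ExprEnv.truthTable o).getD (ofBitList (List.ofFn b)) false = o b := by
  rw [ofBitList_ofFn, ExprEnv.truthTable]
  have h := Nat.ofBits_lt_two_pow b
  simp [List.getD, h]

variable (p : (List (List ℕ) × List ℕ) × ℕ)

/-- The positive tag makes the inequality strict; tag 0 belongs to words, which have no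
subexpressions. -/
theorem lt_pair_succ_left (c m n : ℕ) : m < Nat.pair (c + 1) (Nat.pair m n) := by
  have h := Nat.add_le_pair (c + 1) (Nat.pair m n)
  have := Nat.left_le_pair m n
  omega

theorem lt_pair_succ_right (c m n : ℕ) : n < Nat.pair (c + 1) (Nat.pair m n) := by
  have h := Nat.add_le_pair (c + 1) (Nat.pair m n)
  have := Nat.right_le_pair m n
  omega

theorem lang_word (n : ℕ) : D.lang p (Nat.pair 0 n) = [substWord p.1.1 n] := by
  rw [lang, covRec, langStep]
  simp

theorem lang_empty (n : ℕ) : D.lang p (Nat.pair 1 n) = [] := by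
  rw [lang, covRec, langStep]
  simp

theorem lang_sum (m n : ℕ) :
    D.lang p (Nat.pair 2 (Nat.pair m n)) = D.lang p m ++ D.lang p n := by
  rw [lang, covRec, langStep]
  simp only [Nat.unpair_pair, covTable_getD _ _ (lt_pair_succ_left 1 m n),
    covTable_getD _ _ (lt_pair_succ_right 1 m n)]
  rfl

theorem lang_cat (m n : ℕ) : D.lang p (Nat.pair 3 (Nat.pair m n)) =
    (D.lang p m).flatMap fun x => (D.lang p n).map (x ++ ·) := by
  rw [lang, covRec, langStep]
  simp only [Nat.unpair_pair, covTable_getD _ _ (lt_pair_succ_left 2 m n),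
    covTable_getD _ _ (lt_pair_succ_right 2 m n)]
  rfl

theorem lang_star (n : ℕ) : D.lang p (Nat.pair 4 n) = powers p.2 (D.lang p n) := by
  have h : n < Nat.pair 4 n := by have := Nat.add_le_pair 4 n; omega
  rw [lang, covRec, langStep]
  simp only [Nat.unpair_pair, covTable_getD _ _ h]
  rfl

theorem lang_suchThat (m n : ℕ) : D.lang p (Nat.pair 5 (Nat.pair m n)) =
    if D.holds p.1 n = true then D.lang p m else [] := by
  rw [lang, covRec, langStep]
  simp only [Nat.unpair_pair, covTable_getD _ _ (lt_pair_succ_left 4 m n)]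
  rfl

theorem lang_memb (m n : ℕ) : D.lang p (Nat.pair 6 (Nat.pair m n)) =
    if substWord p.1.1 m ∈ D.lang p n then [substWord p.1.1 m] else [] := by
  rw [lang, covRec, langStep]
  simp only [Nat.unpair_pair, covTable_getD _ _ (lt_pair_succ_right 5 m n)]
  rfl

theorem powers_succ (k : ℕ) (l : List (List ℕ)) :
    powers (k + 1) l = [] :: (powers k l).flatMap fun x => l.map (x ++ ·) := by
  rw [powers, Function.iterate_succ_apply']; rfl

/-- Each iteration multiplies on the right and puts the empty word back, so the last factor is split
off and shorter products survive. -/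
theorem flatten_mem_powers {l : List (List ℕ)} (L : List (List ℕ)) (hL : ∀ x ∈ L, x ∈ l)
    {k : ℕ} (hk : L.length ≤ k) : L.flatten ∈ powers k l := by
  induction k generalizing L with
  | zero => simp [List.length_eq_zero_iff.1 (Nat.le_zero.1 hk), powers]
  | succ k ih =>
    rw [powers_succ]
    induction L using List.reverseRecOn with
    | nil => simp
    | append_singleton L x =>
      simp only [List.length_append, List.length_singleton, Nat.add_le_add_iff_right] at hk
      refine List.mem_cons_of_mem _ (List.mem_flatMap.2 ⟨L.flatten, ih L (fun y hy => hL y ?_) hk,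
        List.mem_map.2 ⟨x, hL x ?_, ?_⟩⟩) <;> simp [*]

theorem exists_flatten_of_mem_powers {l : List (List ℕ)} {k : ℕ} {x : List ℕ}
    (h : x ∈ powers k l) : ∃ L : List (List ℕ), (∀ y ∈ L, y ∈ l) ∧ L.flatten = x := by
  induction k generalizing x with
  | zero => exact ⟨[], by simp, by simpa [powers, eq_comm] using h⟩
  | succ k ih =>
    rw [powers_succ, List.mem_cons, List.mem_flatMap] at h
    rcases h with rfl | ⟨y, hy, hx⟩
    · exact ⟨[], by simp, rfl⟩
    · obtain ⟨z, hz, rfl⟩ := List.mem_map.1 hx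
      obtain ⟨L, hL, rfl⟩ := ih hy
      refine ⟨L ++ [z], fun y hy => ?_, by simp⟩
      rcases List.mem_append.1 hy with hy | hy
      · exact hL y hy
      · rwa [List.mem_singleton.1 hy]

end NFData

/-! ### Environments and their data -/

namespace ExprEnv

variable {𝓔 : ExprEnv.{u, v, w, x}}

/-- The function symbols whose interpretation is prescribed. -/
inductive IsFixed : ∀ {k : ℕ}, 𝓔.lang.Functions k → Prop
  | letter (a : 𝓔.Sym) : IsFixed (𝓔.letter a)
  | eps : IsFixed 𝓔.eps
  | conc : IsFixed 𝓔.conc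

open Classical in
/-- The interpretation of all function symbols that agrees with `G` on those whose
interpretation is not prescribed. -/
noncomputable def extendFunMap
    (G : ∀ {k : ℕ}, 𝓔.lang.Functions k → (Fin k → List 𝓔.Sym) → List 𝓔.Sym) :
    ∀ {k : ℕ}, 𝓔.lang.Functions k → (Fin k → List 𝓔.Sym) → List 𝓔.Sym
  | 0, f, e => if h : ∃ a, f = 𝓔.letter a then [h.choose] else if f = 𝓔.eps then [] else G f e
  | 2, f, e => if f = 𝓔.conc then e 0 ++ e 1 else G f e
  | _, f, e => G f e

section ExtendFunMap

variable (G : ∀ {k : ℕ}, 𝓔.lang.Functions k → (Fin k → List 𝓔.Sym) → List 𝓔.Sym)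

theorem extendFunMap_letter (a : 𝓔.Sym) (e : Fin 0 → List 𝓔.Sym) :
    extendFunMap G (𝓔.letter a) e = [a] := by
  have h : ∃ b, 𝓔.letter a = 𝓔.letter b := ⟨a, rfl⟩
  rw [extendFunMap, dif_pos h, ← 𝓔.letter_injective h.choose_spec]

theorem extendFunMap_eps (e : Fin 0 → List 𝓔.Sym) : extendFunMap G 𝓔.eps e = [] := by
  rw [extendFunMap, dif_neg fun ⟨a, h⟩ => 𝓔.letter_ne_eps a h.symm, if_pos rfl]

theorem extendFunMap_conc (e : Fin 2 → List 𝓔.Sym) :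
    extendFunMap G 𝓔.conc e = e 0 ++ e 1 := by
  rw [extendFunMap, if_pos rfl]

theorem extendFunMap_of_not_isFixed {k : ℕ} {f : 𝓔.lang.Functions k} (hf : ¬ IsFixed f)
    (e : Fin k → List 𝓔.Sym) : extendFunMap G f e = G f e := by
  match k, f, e, hf with
  | 0, f, e, hf =>
    rw [extendFunMap, dif_neg, if_neg]
    · rintro rfl; exact hf .eps
    · rintro ⟨a, rfl⟩; exact hf (.letter a)
  | 1, f, e, hf => rw [extendFunMap] <;> simp
  | 2, f, e, hf =>
    rw [extendFunMap, if_neg]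
    rintro rfl; exact hf .conc
  | k + 3, f, e, hf => rw [extendFunMap] <;> simp

end ExtendFunMap

/-- The number of a letter, as a generalized letter. -/
def Numbering.letterNum (ν : Numbering 𝓔) : 𝓔.Sym ↪ ℕ :=
  ⟨fun a => Nat.pair 0 (ν.sym a), fun _ _ h => ν.sym.injective (Nat.pair_eq_pair.1 h).2⟩

theorem Numbering.inputWord_codeWord (ν : Numbering 𝓔) (u : List 𝓔.Sym) :
    NFData.inputWord (ν.codeWord u) = u.map ν.letterNum := by
  rw [NFData.inputWord, codeWord, Denumerable.ofNat_encode, List.map_map]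
  rfl

theorem Numbering.substWord_codeMixed (ν : Numbering 𝓔) (S : List (List ℕ))
    (α : List (𝓔.Sym ⊕ 𝓔.Var)) : NFData.substWord S (ν.codeMixed α) =
      α.flatMap (Sum.elim (fun a => [ν.letterNum a]) fun y => S.getD (ν.var y) []) := by
  rw [NFData.substWord, codeMixed, encodek, Option.getD_some, List.flatMap_map]
  congr 1
  funext s
  cases s <;> rfl

theorem lt_pair_encode_ofFn {k : ℕ} (g : Fin k → ℕ) (i : Fin k) (m n : ℕ) :
    g i < Nat.pair m (Nat.pair n (encode (List.ofFn g))) :=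
  (lt_encode_of_mem (List.mem_ofFn.2 ⟨i, rfl⟩)).trans_le
    ((Nat.right_le_pair _ _).trans (Nat.right_le_pair _ _))

theorem Numbering.codeTerm_lt_codeTerm (ν : Numbering 𝓔) {k : ℕ} (f : 𝓔.lang.Functions k)
    (t : Fin k → 𝓔.lang.Term 𝓔.Var) (i : Fin k) :
    ν.codeTerm (t i) < ν.codeTerm (.func f t) := by
  rw [codeTerm]
  exact lt_pair_encode_ofFn (fun j => ν.codeTerm (t j)) i _ _

theorem Numbering.codeTerm_lt_codeFormula (ν : Numbering 𝓔) {k : ℕ} (P : 𝓔.lang.Relations k)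
    (t : Fin k → 𝓔.lang.Term 𝓔.Var) (i : Fin k) :
    ν.codeTerm (t i) < ν.codeFormula (.atom P t) := by
  rw [codeFormula]
  exact lt_pair_encode_ofFn (fun j => ν.codeTerm (t j)) i _ _

theorem Numbering.codeFormula_lt_codeFormula (ν : Numbering 𝓔) {k : ℕ}
    (o : (Fin k → Bool) → Bool) (φ : Fin k → Formula 𝓔) (i : Fin k) :
    ν.codeFormula (φ i) < ν.codeFormula (.op o φ) := by
  rw [codeFormula]
  exact lt_pair_encode_ofFn (fun j => ν.codeFormula (φ j)) i _ _

/-- The data `D` describe the environment with the numbering `ν`. -/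
structure Numbering.Describes (ν : Numbering 𝓔) (D : NFData) : Prop where
  constNF_letter (a : 𝓔.Sym) : D.constNF (ν.fn 0 (𝓔.letter a)) = some [ν.letterNum a]
  constNF_eps : D.constNF (ν.fn 0 𝓔.eps) = some []
  constNF_of_not_isFixed (f : 𝓔.lang.Functions 0) :
    ¬ IsFixed f → D.constNF (ν.fn 0 f) = none
  conc_eq : D.conc = ν.fn 2 𝓔.conc
  flatMap_eq_of_canon_eq (g : ℕ → List 𝓔.Sym) (l m : List ℕ) :
    D.canon l = D.canon m → l.flatMap g = m.flatMap g
  exists_separating (F : Set (List ℕ)) : F.Finite → ∃ g : ℕ → List 𝓔.Sym,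
    (∀ a, g (ν.letterNum a) = [a]) ∧
      ∀ l ∈ F, ∀ m ∈ F, l.flatMap g = m.flatMap g → D.canon l = D.canon m

/-- The congruence comes from `exists_canon`. The table of fixed constants is computable because Σ
is finite. -/
theorem Numbering.exists_describes (ν : Numbering 𝓔) : ∃ D : NFData, ν.Describes D := by
  classical
  have := 𝓔.finite_sym
  obtain ⟨κ, hκ, hκ₁, hκ₂⟩ := exists_canon ν.letterNum
  let c : ℕ → Option (List ℕ) := fun n =>
    if h : ∃ a, ν.fn 0 (𝓔.letter a) = n then some [ν.letterNum h.choose]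
    else if n = ν.fn 0 𝓔.eps then some [] else none
  obtain ⟨N, hN⟩ := (Set.finite_range fun a => ν.fn 0 (𝓔.letter a)).bddAbove
  have hc : Primrec c := by
    -- Beyond the largest number of a letter constant or of ε there are no prescribed values.
    refine Primrec.of_eventually_const (max N (ν.fn 0 𝓔.eps) + 1) none fun n hn => ?_
    have h₁ : ¬ ∃ a, ν.fn 0 (𝓔.letter a) = n := by
      intro h
      have := hN h
      omega
    have h₂ : n ≠ ν.fn 0 𝓔.eps := by omega
    simp only [c, dif_neg h₁, if_neg h₂]
  refine ⟨⟨κ, c, ν.fn 2 𝓔.conc, hκ, hc⟩, fun a => ?_, ?_, fun f hf => ?_, rfl, hκ₁, hκ₂⟩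
  · have h : ∃ b, ν.fn 0 (𝓔.letter b) = ν.fn 0 (𝓔.letter a) := ⟨a, rfl⟩
    simp only [c, dif_pos h]
    rw [𝓔.letter_injective ((ν.fn 0).injective h.choose_spec)]
  · have h : ¬ ∃ b, ν.fn 0 (𝓔.letter b) = ν.fn 0 𝓔.eps := fun ⟨a, h⟩ =>
      𝓔.letter_ne_eps a ((ν.fn 0).injective h)
    simp only [c, dif_neg h, if_true]
  · have h₁ : ¬ ∃ b, ν.fn 0 (𝓔.letter b) = ν.fn 0 f := by
      rintro ⟨a, h⟩
      obtain rfl := (ν.fn 0).injective h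
      exact hf (.letter a)
    have h₂ : ν.fn 0 f ≠ ν.fn 0 𝓔.eps := by
      intro h
      obtain rfl := (ν.fn 0).injective h
      exact hf .eps
    simp only [c, dif_neg h₁, if_neg h₂]

/-- The normal form of a term. -/
def Numbering.termNF (ν : Numbering 𝓔) (D : NFData) (S : List (List ℕ))
    (t : 𝓔.lang.Term 𝓔.Var) : List ℕ := D.nf S (ν.codeTerm t)

/-- The generalized letter for a function symbol applied to terms. -/
def Numbering.termGen (ν : Numbering 𝓔) (D : NFData) (S : List (List ℕ)) {k : ℕ}
    (f : 𝓔.lang.Functions k) (t : Fin k → 𝓔.lang.Term 𝓔.Var) : ℕ :=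
  D.gen (ν.fn k f) (List.ofFn fun i => ν.termNF D S (t i))

/-! ### Normal forms of terms and atoms -/

section NormalForms

variable (ν : Numbering 𝓔) {D : NFData} (S : List (List ℕ))

theorem Numbering.termNF_var (y : 𝓔.Var) : ν.termNF D S (.var y) = S.getD (ν.var y) [] := by
  rw [termNF, codeTerm, D.nf_pair_zero]

theorem Numbering.termNF_func {k : ℕ} (f : 𝓔.lang.Functions k)
    (t : Fin k → 𝓔.lang.Term 𝓔.Var) : ν.termNF D S (.func f t) =
      D.app (ν.fn k f) (List.ofFn fun i => ν.termNF D S (t i)) := by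
  rw [termNF, codeTerm, D.nf_pair_one, List.map_ofFn]
  rfl

variable {ν}

theorem Numbering.Describes.termNF_letter (hD : ν.Describes D) (a : 𝓔.Sym)
    (t : Fin 0 → 𝓔.lang.Term 𝓔.Var) :
    ν.termNF D S (.func (𝓔.letter a) t) = [ν.letterNum a] := by
  rw [termNF_func, NFData.app, if_pos List.length_ofFn, hD.constNF_letter, Option.getD_some]

theorem Numbering.Describes.termNF_eps (hD : ν.Describes D)
    (t : Fin 0 → 𝓔.lang.Term 𝓔.Var) : ν.termNF D S (.func 𝓔.eps t) = [] := by
  rw [termNF_func, NFData.app, if_pos List.length_ofFn, hD.constNF_eps, Option.getD_some]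

theorem Numbering.Describes.termNF_conc (hD : ν.Describes D)
    (t : Fin 2 → 𝓔.lang.Term 𝓔.Var) :
    ν.termNF D S (.func 𝓔.conc t) = ν.termNF D S (t 0) ++ ν.termNF D S (t 1) := by
  rw [termNF_func, NFData.app, if_neg (by simp), if_pos ⟨List.length_ofFn, hD.conc_eq.symm⟩]
  simp [List.ofFn_succ]

theorem Numbering.Describes.termNF_of_not_isFixed (hD : ν.Describes D) {k : ℕ}
    {f : 𝓔.lang.Functions k} (hf : ¬ IsFixed f) (t : Fin k → 𝓔.lang.Term 𝓔.Var) :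
    ν.termNF D S (.func f t) = [ν.termGen D S f t] := by
  rw [termNF_func, NFData.app]
  split_ifs with h₀ h₂
  · obtain rfl : k = 0 := by simpa using h₀
    rw [hD.constNF_of_not_isFixed f hf]
    rfl
  · obtain rfl : k = 2 := by simpa using h₂.1
    obtain rfl := (ν.fn 2).injective (h₂.2.trans hD.conc_eq)
    exact (hf .conc).elim
  · rfl

theorem Numbering.termGen_congr {k : ℕ} (f : 𝓔.lang.Functions k)
    {s t : Fin k → 𝓔.lang.Term 𝓔.Var}
    (h : ∀ i, D.canon (ν.termNF D S (s i)) = D.canon (ν.termNF D S (t i))) :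
    ν.termGen D S f s = ν.termGen D S f t := by
  unfold termGen NFData.gen
  simp only [List.map_ofFn, Function.comp_def, h]

/-- Function symbols are numbered injectively only within one arity, so the arity must be recovered
first, from the length of the argument list. -/
theorem Numbering.arity_eq_of_termGen_eq {k k' : ℕ} {f : 𝓔.lang.Functions k}
    {f' : 𝓔.lang.Functions k'} {s : Fin k → 𝓔.lang.Term 𝓔.Var}
    {t : Fin k' → 𝓔.lang.Term 𝓔.Var} (h : ν.termGen D S f s = ν.termGen D S f' t) :
    k = k' := by
  simpa using congrArg List.length (D.gen_inj h).2

theorem Numbering.termGen_inj {k : ℕ} {f f' : 𝓔.lang.Functions k}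
    {s t : Fin k → 𝓔.lang.Term 𝓔.Var} (h : ν.termGen D S f s = ν.termGen D S f' t) :
    f = f' ∧ ∀ i, D.canon (ν.termNF D S (s i)) = D.canon (ν.termNF D S (t i)) := by
  obtain ⟨h₁, h₂⟩ := D.gen_inj h
  rw [List.map_ofFn, List.map_ofFn] at h₂
  exact ⟨(ν.fn k).injective h₁, congrFun (List.ofFn_injective h₂)⟩

variable (ν)

theorem Numbering.atomNF_codeFormula {k : ℕ} (P : 𝓔.lang.Relations k)
    (t : Fin k → 𝓔.lang.Term 𝓔.Var) : D.atomNF S (ν.codeFormula (.atom P t)) =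
      Nat.pair (ν.pred k P) (encode (List.ofFn fun i => D.canon (ν.termNF D S (t i)))) := by
  rw [codeFormula, D.atomNF_pair, List.map_ofFn]
  rfl

theorem Numbering.holds_atom (T : List ℕ) {k : ℕ} (P : 𝓔.lang.Relations k)
    (t : Fin k → 𝓔.lang.Term 𝓔.Var) : D.holds (S, T) (ν.codeFormula (.atom P t)) =
      decide (D.atomNF S (ν.codeFormula (.atom P t)) ∈ T) := by
  rw [codeFormula, D.holds_pair_zero]

theorem Numbering.holds_op (T : List ℕ) {k : ℕ} (o : (Fin k → Bool) → Bool)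
    (φ : Fin k → Formula 𝓔) : D.holds (S, T) (ν.codeFormula (.op o φ)) =
      o fun i => D.holds (S, T) (ν.codeFormula (φ i)) := by
  rw [codeFormula, D.holds_pair_one, List.map_ofFn, NFData.truthTable_getD_ofBitList]
  rfl

end NormalForms

end ExprEnv

namespace ExprEnv

variable {𝓔 : ExprEnv.{u, v, w, x}} (ν : Numbering 𝓔) {D : NFData} (S : List (List ℕ))

/-- The homomorphic extension of `g` commutes with substitution into words. -/
theorem flatMap_substWord {g : ℕ → List 𝓔.Sym} (hg : ∀ a, g (ν.letterNum a) = [a])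
    {r : 𝓔.Var → List 𝓔.Sym} {α : List (𝓔.Sym ⊕ 𝓔.Var)}
    (hr : ∀ y, Sum.inr y ∈ α → (S.getD (ν.var y) []).flatMap g = r y) :
    (NFData.substWord S (ν.codeMixed α)).flatMap g = realizeWord r α := by
  rw [ν.substWord_codeMixed, realizeWord]
  induction α with
  | nil => rfl
  | cons s α ih =>
    rw [List.flatMap_cons, List.flatMap_append, List.flatMap_cons,
      ih fun y hy => hr y (List.mem_cons_of_mem _ hy)]
    cases s with
    | inl a => simp [hg]
    | inr y => simp only [Sum.elim_inr, hr y List.mem_cons_self]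

theorem flatMap_map_letterNum {g : ℕ → List 𝓔.Sym} (hg : ∀ a, g (ν.letterNum a) = [a])
    (s : List 𝓔.Sym) : (s.map ν.letterNum).flatMap g = s := by
  simp [List.flatMap_map, hg]

/-! ### Soundness -/

section Soundness

variable (D) (T : List ℕ) (e₀ : ℕ) (g : ℕ → List 𝓔.Sym)

open Classical in
/-- The interpretation of the free function symbols induced by the values `g` of the generalized
letters, as far as terms with number less than `e₀` are concerned. -/
noncomputable def genericFun {k : ℕ} (f : 𝓔.lang.Functions k) (e : Fin k → List 𝓔.Sym) :
    List 𝓔.Sym :=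
  if h : ∃ t : Fin k → 𝓔.lang.Term 𝓔.Var, ν.codeTerm (.func f t) < e₀ ∧
      ∀ i, (ν.termNF D S (t i)).flatMap g = e i then
    g (ν.termGen D S f h.choose) else []

/-- The interpretation induced by the values `g` of the generalized letters and the set `T` of
normal forms of true atoms. -/
noncomputable def genericInterp : ExprInterp 𝓔 where
  interp :=
    { funMap := fun f e => extendFunMap (genericFun ν D S e₀ g) f e
      RelMap := fun P e => ∃ t, ν.codeFormula (.atom P t) < e₀ ∧
        (∀ i, (ν.termNF D S (t i)).flatMap g = e i) ∧
        D.atomNF S (ν.codeFormula (.atom P t)) ∈ T }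
  interp_letter := extendFunMap_letter _
  interp_eps := extendFunMap_eps _
  interp_conc := extendFunMap_conc _

/-- The realization induced by the values `g` of the generalized letters. -/
def genericRealization (y : 𝓔.Var) : List 𝓔.Sym := (S.getD (ν.var y) []).flatMap g

variable {ν S D T e₀ g}

/-- The choice of a preimage in `genericFun` is harmless: by separation, argument tuples with equal
values have congruent normal forms, hence yield the same generalized letter. The bound `e₀` confines
this to the finitely many separated words. -/
theorem termValue_genericInterp (hD : ν.Describes D) (hg : ∀ a, g (ν.letterNum a) = [a])
    (hsep : ∀ l < e₀, ∀ m < e₀, (D.nf S l).flatMap g = (D.nf S m).flatMap g →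
      D.canon (D.nf S l) = D.canon (D.nf S m))
    (t : 𝓔.lang.Term 𝓔.Var) (ht : ν.codeTerm t < e₀) :
    (genericInterp ν D S T e₀ g).termValue (genericRealization ν S g) t =
      (ν.termNF D S t).flatMap g := by
  induction t with
  | var y => rw [ν.termNF_var]; rfl
  | @func k f t ih =>
    have hlt (i : Fin k) : ν.codeTerm (t i) < e₀ := (ν.codeTerm_lt_codeTerm f t i).trans ht
    have hval : (genericInterp ν D S T e₀ g).termValue (genericRealization ν S g) (.func f t) =
        extendFunMap (genericFun ν D S e₀ g) f fun i => (ν.termNF D S (t i)).flatMap g :=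
      congrArg _ (funext fun i => ih i (hlt i))
    rw [hval]
    by_cases hf : IsFixed f
    · cases hf with
      | letter a => rw [extendFunMap_letter, hD.termNF_letter]; simp [hg]
      | eps => rw [extendFunMap_eps, hD.termNF_eps]; rfl
      | conc => rw [extendFunMap_conc, hD.termNF_conc, List.flatMap_append]
    · rw [extendFunMap_of_not_isFixed _ hf, hD.termNF_of_not_isFixed S hf]
      have h : ∃ s : Fin k → 𝓔.lang.Term 𝓔.Var, ν.codeTerm (.func f s) < e₀ ∧
        ∀ i, (ν.termNF D S (s i)).flatMap g = (ν.termNF D S (t i)).flatMap g :=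
        ⟨t, ht, fun _ => rfl⟩
      rw [genericFun, dif_pos h, ν.termGen_congr S f fun i => hsep _
        ((ν.codeTerm_lt_codeTerm f _ i).trans h.choose_spec.1) _ (hlt i) (h.choose_spec.2 i)]
      simp

/-- Separation again: an atom made true by another tuple with the same values has the same normal
form, so `T` decides both alike. -/
theorem eval_genericInterp (hD : ν.Describes D) (hg : ∀ a, g (ν.letterNum a) = [a])
    (hsep : ∀ l < e₀, ∀ m < e₀, (D.nf S l).flatMap g = (D.nf S m).flatMap g →
      D.canon (D.nf S l) = D.canon (D.nf S m))
    (φ : Formula 𝓔) (hφ : ν.codeFormula φ < e₀) :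
    φ.eval (genericInterp ν D S T e₀ g) (genericRealization ν S g) =
      D.holds (S, T) (ν.codeFormula φ) := by
  induction φ with
  | @atom k P t =>
    have hlt (i : Fin k) := (ν.codeTerm_lt_codeFormula P t i).trans hφ
    rw [Formula.eval, ν.holds_atom, decide_eq_decide,
      funext fun i => termValue_genericInterp hD hg hsep (t i) (hlt i)]
    constructor
    · rintro ⟨s, hs, hst, hT⟩
      rw [ν.atomNF_codeFormula] at hT ⊢
      have hcanon (i : Fin k) :
          D.canon (ν.termNF D S (s i)) = D.canon (ν.termNF D S (t i)) :=
        hsep _ ((ν.codeTerm_lt_codeFormula P s i).trans hs) _ (hlt i) (hst i)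
      rwa [funext hcanon] at hT
    · exact fun hT => ⟨t, hφ, fun _ => rfl, hT⟩
  | op o φ ih =>
    rw [Formula.eval, ν.holds_op]
    exact congrArg o (funext fun i => ih i ((ν.codeFormula_lt_codeFormula o φ i).trans hφ))

theorem flatMap_mem_langIR (hD : ν.Describes D) (hg : ∀ a, g (ν.letterNum a) = [a])
    (hsep : ∀ l < e₀, ∀ m < e₀, (D.nf S l).flatMap g = (D.nf S m).flatMap g →
      D.canon (D.nf S l) = D.canon (D.nf S m))
    (k : ℕ) (E : CExpr 𝓔) (hE : ν.codeExpr E ≤ e₀) (s : List ℕ)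
    (hs : s ∈ D.lang ((S, T), k) (ν.codeExpr E)) :
    s.flatMap g ∈ E.langIR (genericInterp ν D S T e₀ g) (genericRealization ν S g) := by
  induction E generalizing s with
  | word α =>
    rw [Numbering.codeExpr, D.lang_word, List.mem_singleton] at hs
    subst hs
    exact flatMap_substWord ν S hg fun _ _ => rfl
  | empty =>
    rw [Numbering.codeExpr, D.lang_empty] at hs
    exact absurd hs List.not_mem_nil
  | sum E F ihE ihF =>
    rw [Numbering.codeExpr] at hs hE
    rw [D.lang_sum, List.mem_append] at hs
    exact hs.imp (ihE ((NFData.lt_pair_succ_left _ _ _).le.trans hE) s)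
      (ihF ((NFData.lt_pair_succ_right _ _ _).le.trans hE) s)
  | cat E F ihE ihF =>
    rw [Numbering.codeExpr] at hs hE
    rw [D.lang_cat, List.mem_flatMap] at hs
    obtain ⟨a, ha, hs⟩ := hs
    obtain ⟨b, hb, rfl⟩ := List.mem_map.1 hs
    rw [List.flatMap_append]
    exact Language.append_mem_mul (ihE ((NFData.lt_pair_succ_left _ _ _).le.trans hE) a ha)
      (ihF ((NFData.lt_pair_succ_right _ _ _).le.trans hE) b hb)
  | star E ih =>
    rw [Numbering.codeExpr] at hs hE
    rw [D.lang_star] at hs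
    obtain ⟨L, hL, rfl⟩ := NFData.exists_flatten_of_mem_powers hs
    have hflat (L : List (List ℕ)) :
        L.flatten.flatMap g = (L.map fun l => l.flatMap g).flatten := by
      induction L <;> simp [*]
    refine Language.mem_kstar.2 ⟨L.map fun l => l.flatMap g, hflat L, fun y hy => ?_⟩
    obtain ⟨l, hl, rfl⟩ := List.mem_map.1 hy
    exact ih ((Nat.right_le_pair _ _).trans hE) l (hL l hl)
  | suchThat E φ ih =>
    rw [Numbering.codeExpr] at hs hE
    rw [D.lang_suchThat] at hs
    split_ifs at hs with h
    · rw [CExpr.langIR, eval_genericInterp hD hg hsep φ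
        ((NFData.lt_pair_succ_right _ _ _).trans_le hE), if_pos h]
      exact ih ((NFData.lt_pair_succ_left _ _ _).le.trans hE) s hs
    · exact absurd hs List.not_mem_nil
  | memb α E ih =>
    rw [Numbering.codeExpr] at hs hE
    rw [D.lang_memb] at hs
    split_ifs at hs with h
    · obtain rfl := List.mem_singleton.1 hs
      exact ⟨flatMap_substWord ν S hg fun _ _ => rfl,
        ih ((NFData.lt_pair_succ_right _ _ _).le.trans hE) _ h⟩
    · exact absurd hs List.not_mem_nil

/-- Nothing is required of `S`, `T` or `k`: every guess is realizable, and bounded powers lie in the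
star. It suffices to separate the normal forms of all numbers below that of `E`, whether or not they
code terms. -/
theorem mem_language_of_mem_lang (hD : ν.Describes D) (S : List (List ℕ)) (T : List ℕ) (k : ℕ)
    (E : CExpr 𝓔) (s : List 𝓔.Sym)
    (hs : s.map ν.letterNum ∈ D.lang ((S, T), k) (ν.codeExpr E)) : s ∈ E.language := by
  obtain ⟨g, hg, hsep⟩ := hD.exists_separating (D.nf S '' Set.Iio (ν.codeExpr E))
    ((Set.finite_Iio _).image _)
  have h := flatMap_mem_langIR (T := T) hD hg
    (fun l hl m hm => hsep _ ⟨l, hl, rfl⟩ _ ⟨m, hm, rfl⟩) k E le_rfl _ hs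
  rw [flatMap_map_letterNum ν hg] at h
  exact ⟨_, _, h⟩

end Soundness

/-! ### Completeness -/

section Completeness

variable (I : ExprInterp 𝓔) (r : 𝓔.Var → List 𝓔.Sym)

/-- An interpretation and a realization give values to the generalized letters; the value of a
function symbol applied to terms is read off a smallest such term. -/
theorem exists_genValue (ν : Numbering 𝓔) (D : NFData) (S : List (List ℕ)) :
    ∃ g : ℕ → List 𝓔.Sym, (∀ a, g (ν.letterNum a) = [a]) ∧
      (∀ y, g (Nat.pair 1 (ν.var y)) = r y) ∧
      ∀ {k : ℕ} (f : 𝓔.lang.Functions k) (t : Fin k → 𝓔.lang.Term 𝓔.Var),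
        ∃ s : Fin k → 𝓔.lang.Term 𝓔.Var, ν.termGen D S f s = ν.termGen D S f t ∧
          ν.codeTerm (.func f s) ≤ ν.codeTerm (.func f t) ∧
          g (ν.termGen D S f t) = I.termValue r (.func f s) := by
  have h (n : ℕ) : ∃ v : List 𝓔.Sym, (∀ a, ν.letterNum a = n → v = [a]) ∧
      (∀ y, Nat.pair 1 (ν.var y) = n → v = r y) ∧
      ∀ (k : ℕ) (f : 𝓔.lang.Functions k) (t : Fin k → 𝓔.lang.Term 𝓔.Var),
        ν.termGen D S f t = n → ∃ s : Fin k → 𝓔.lang.Term 𝓔.Var,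
          ν.termGen D S f s = n ∧ ν.codeTerm (.func f s) ≤ ν.codeTerm (.func f t) ∧
          v = I.termValue r (.func f s) := by
    have tag {a b c d : ℕ} (hab : a ≠ b) : Nat.pair a c ≠ Nat.pair b d :=
      fun h => hab (Nat.pair_eq_pair.1 h).1
    by_cases h₀ : ∃ a, ν.letterNum a = n
    · obtain ⟨a, rfl⟩ := h₀
      exact ⟨[a], fun b hb => by rw [ν.letterNum.injective hb],
        fun y hy => (tag one_ne_zero hy).elim, fun k f t ht => (tag two_ne_zero ht).elim⟩
    by_cases h₁ : ∃ y, Nat.pair 1 (ν.var y) = n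
    · obtain ⟨y, rfl⟩ := h₁
      exact ⟨r y, fun b hb => (tag zero_ne_one hb).elim,
        fun z hz => by rw [ν.var.injective (Nat.pair_eq_pair.1 hz).2],
        fun k f t ht => (tag (by decide) ht).elim⟩
    let X := Σ k : ℕ, 𝓔.lang.Functions k × (Fin k → 𝓔.lang.Term 𝓔.Var)
    let A : Set X := {p | ν.termGen D S p.2.1 p.2.2 = n}
    rcases A.eq_empty_or_nonempty with hA | hA
    · refine ⟨[], fun a ha => (h₀ ⟨a, ha⟩).elim, fun y hy => (h₁ ⟨y, hy⟩).elim,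
        fun k f t ht => ?_⟩
      have : (⟨k, f, t⟩ : X) ∈ A := ht
      simp [hA] at this
    -- Many terms may share the generalized letter `n`. Taking one of least code makes later
    -- inductions on codes apply to its arguments.
    · let μ : X → ℕ := fun p => ν.codeTerm (.func p.2.1 p.2.2)
      let p := Function.argminOn μ A hA
      have hp : p ∈ A := Function.argminOn_mem μ A hA
      refine ⟨I.termValue r (.func p.2.1 p.2.2), fun a ha => (h₀ ⟨a, ha⟩).elim,
        fun y hy => (h₁ ⟨y, hy⟩).elim, fun k f t ht => ?_⟩
      have hle : μ p ≤ μ ⟨k, f, t⟩ := Function.argminOn_le μ A ht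
      obtain ⟨k', f', s⟩ := p
      have hs : ν.termGen D S f' s = n := hp
      obtain rfl := Numbering.arity_eq_of_termGen_eq S (hs.trans ht.symm)
      obtain rfl := (Numbering.termGen_inj S (hs.trans ht.symm)).1
      exact ⟨s, hs, hle, rfl⟩
  choose g hg₀ hg₁ hg₂ using h
  exact ⟨g, fun a => hg₀ _ a rfl, fun y => hg₁ _ y rfl, fun f t => hg₂ _ _ f t rfl⟩

variable {ν I r}

/-- The value of a free generalized letter comes from a representative term whose arguments have
normal forms congruent to the given ones, and congruent words have equal images under `g`. -/
theorem exists_flatMap_termNF (hD : ν.Describes D)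
    (hS : ∀ y, S.getD (ν.var y) [] = [Nat.pair 1 (ν.var y)] ∨
      S.getD (ν.var y) [] = (r y).map ν.letterNum) :
    ∃ g : ℕ → List 𝓔.Sym, ∀ t, (ν.termNF D S t).flatMap g = I.termValue r t := by
  obtain ⟨g, hg₀, hg₁, hg₂⟩ := exists_genValue I r ν D S
  refine ⟨g, fun t => ?_⟩
  -- Structural induction would not suffice: the arguments of the representative are not subterms of
  -- `t`, but their codes are smaller.
  induction hn : ν.codeTerm t using Nat.strong_induction_on generalizing t with
  | _ n ih =>
  subst hn
  cases t with
  | var y =>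
    rw [ν.termNF_var]
    rcases hS y with h | h
    · rw [h]; simp [hg₁]; rfl
    · rw [h, flatMap_map_letterNum ν hg₀]; rfl
  | @func k f t =>
    have ih' (s : 𝓔.lang.Term 𝓔.Var) (hs : ν.codeTerm s < ν.codeTerm (.func f t)) :
      (ν.termNF D S s).flatMap g = I.termValue r s := ih _ hs s rfl
    have hlt := ν.codeTerm_lt_codeTerm f t
    by_cases hf : IsFixed f
    · cases hf with
      | letter a =>
        rw [hD.termNF_letter, List.flatMap_singleton, hg₀]
        exact (I.interp_letter a _).symm
      | eps => rw [hD.termNF_eps]; exact (I.interp_eps _).symm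
      | conc =>
        rw [hD.termNF_conc, List.flatMap_append, ih' _ (hlt 0), ih' _ (hlt 1)]
        exact (I.interp_conc fun i => I.termValue r (t i)).symm
    · obtain ⟨s, hs, hle, hv⟩ := hg₂ f t
      rw [hD.termNF_of_not_isFixed S hf, List.flatMap_singleton, hv]
      refine congrArg (I.interp.funMap f) (funext fun i => ?_)
      have h := hD.flatMap_eq_of_canon_eq g _ _ ((Numbering.termGen_inj S hs).2 i)
      rw [ih' _ ((ν.codeTerm_lt_codeTerm f s i).trans_le hle), ih' _ (hlt i)] at h
      exact h

/-- Atoms with equal normal forms have the same predicate and arguments of equal value, so their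
truth under `I` and `r` depends only on the normal form. -/
theorem holds_eq_eval (hD : ν.Describes D)
    (hS : ∀ y, S.getD (ν.var y) [] = [Nat.pair 1 (ν.var y)] ∨
      S.getD (ν.var y) [] = (r y).map ν.letterNum) {T : List ℕ} {e₀ : ℕ}
    (hT : ∀ n, n ∈ T ↔ n ∈ (List.range e₀).map (D.atomNF S) ∧
      ∃ (k : ℕ) (P : 𝓔.lang.Relations k) (t : Fin k → 𝓔.lang.Term 𝓔.Var),
        D.atomNF S (ν.codeFormula (.atom P t)) = n ∧
          I.interp.RelMap P fun i => I.termValue r (t i))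
    (φ : Formula 𝓔) (hφ : ν.codeFormula φ < e₀) :
    D.holds (S, T) (ν.codeFormula φ) = φ.eval I r := by
  obtain ⟨g, hg⟩ := exists_flatMap_termNF (I := I) S hD hS
  induction φ with
  | @atom k P t =>
    rw [Formula.eval, ν.holds_atom, decide_eq_decide, hT]
    constructor
    · rintro ⟨-, k', P', s, hst, hs⟩
      rw [ν.atomNF_codeFormula, ν.atomNF_codeFormula] at hst
      obtain ⟨hP, henc⟩ := Nat.pair_eq_pair.1 hst
      have hl := encode_injective henc
      obtain rfl : k' = k := by simpa using congrArg List.length hl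
      obtain rfl := (ν.pred k').injective hP
      have hcanon := congrFun (List.ofFn_injective hl)
      convert hs using 2 with i
      rw [← hg, ← hg]
      exact hD.flatMap_eq_of_canon_eq g _ _ (hcanon i).symm
    · exact fun h => ⟨List.mem_map.2 ⟨_, List.mem_range.2 hφ, rfl⟩, k, P, t, rfl, h⟩
  | op o φ ih =>
    rw [Formula.eval, ν.holds_op]
    exact congrArg o (funext fun i => ih i ((ν.codeFormula_lt_codeFormula o φ i).trans hφ))

/-- The induction runs over all subsequences `s` of the input `s₀`, since factors of subsequences
are again subsequences. -/
theorem map_mem_lang (hD : ν.Describes D)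
    (hS : ∀ y, S.getD (ν.var y) [] = [Nat.pair 1 (ν.var y)] ∨
      S.getD (ν.var y) [] = (r y).map ν.letterNum) {T : List ℕ} {e₀ : ℕ}
    (hT : ∀ n, n ∈ T ↔ n ∈ (List.range e₀).map (D.atomNF S) ∧
      ∃ (k : ℕ) (P : 𝓔.lang.Relations k) (t : Fin k → 𝓔.lang.Term 𝓔.Var),
        D.atomNF S (ν.codeFormula (.atom P t)) = n ∧
          I.interp.RelMap P fun i => I.termValue r (t i))
    {s₀ : List 𝓔.Sym}
    (hS₀ : ∀ y, (r y).Sublist s₀ → S.getD (ν.var y) [] = (r y).map ν.letterNum)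
    (E : CExpr 𝓔) (hE : ν.codeExpr E ≤ e₀) (s : List 𝓔.Sym) (hs : s.Sublist s₀)
    (hsE : s ∈ E.langIR I r) :
    s.map ν.letterNum ∈ D.lang ((S, T), s₀.length) (ν.codeExpr E) := by
  -- The value of each variable occurring in `α` is a factor of the realized word, hence a
  -- subsequence of `s₀`, so `S` spells it out.
  have hword (α : List (𝓔.Sym ⊕ 𝓔.Var)) (hα : (realizeWord r α).Sublist s₀) :
      NFData.substWord S (ν.codeMixed α) = (realizeWord r α).map ν.letterNum := by
    rw [ν.substWord_codeMixed]
    induction α with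
    | nil => rfl
    | cons x α ih =>
      rw [realizeWord, List.flatMap_cons] at hα ⊢
      rw [List.flatMap_cons, List.map_append, ih ((List.sublist_append_right _ _).trans hα)]
      congr 1
      cases x with
      | inl a => rfl
      | inr y => exact hS₀ y ((List.sublist_append_left _ _).trans hα)
  induction E generalizing s with
  | word α =>
    obtain rfl : s = realizeWord r α := hsE
    rw [Numbering.codeExpr, D.lang_word, List.mem_singleton]
    exact (hword α hs).symm
  | empty => exact hsE.elim
  | sum E F ihE ihF =>
    rw [Numbering.codeExpr] at hE ⊢
    rw [D.lang_sum, List.mem_append]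
    exact Or.imp (ihE ((NFData.lt_pair_succ_left _ _ _).le.trans hE) s hs)
      (ihF ((NFData.lt_pair_succ_right _ _ _).le.trans hE) s hs) hsE
  | cat E F ihE ihF =>
    rw [Numbering.codeExpr] at hE ⊢
    obtain ⟨a, ha, b, hb, rfl⟩ := Language.mem_mul.1 hsE
    rw [D.lang_cat, List.mem_flatMap]
    refine ⟨_, ihE ((NFData.lt_pair_succ_left _ _ _).le.trans hE) a
      ((List.sublist_append_left _ _).trans hs) ha, List.mem_map.2
      ⟨_, ihF ((NFData.lt_pair_succ_right _ _ _).le.trans hE) b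
      ((List.sublist_append_right _ _).trans hs) hb, List.map_append.symm⟩⟩
  | star E ih =>
    rw [Numbering.codeExpr] at hE ⊢
    -- With nonempty factors, their number is at most the length of `s`, hence at most that of `s₀`.
    obtain ⟨L, rfl, hL⟩ := Language.mem_kstar_iff_exists_nonempty.1 hsE
    rw [D.lang_star, List.map_flatten]
    refine NFData.flatten_mem_powers _ (fun x hx => ?_) ?_
    · obtain ⟨l, hl, rfl⟩ := List.mem_map.1 hx
      exact ih ((Nat.right_le_pair _ _).trans hE) l ((List.sublist_flatten_of_mem hl).trans hs)
        (hL l hl).1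
    · rw [List.length_map]
      refine le_trans ?_ hs.length_le
      rw [List.length_flatten, ← List.length_map List.length]
      refine List.length_le_sum_of_one_le _ fun n hn => ?_
      obtain ⟨l, hl, rfl⟩ := List.mem_map.1 hn
      exact List.length_pos_iff.2 (hL l hl).2
  | suchThat E φ ih =>
    rw [Numbering.codeExpr] at hE ⊢
    rw [CExpr.langIR] at hsE
    rw [D.lang_suchThat,
      holds_eq_eval S hD hS hT φ ((NFData.lt_pair_succ_right _ _ _).trans_le hE)]
    split_ifs at hsE ⊢ with h
    · exact ih ((NFData.lt_pair_succ_left _ _ _).le.trans hE) s hs hsE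
    · exact hsE.elim
  | memb α E ih =>
    obtain ⟨rfl, hsE⟩ := hsE
    rw [Numbering.codeExpr] at hE ⊢
    have h := ih ((NFData.lt_pair_succ_right _ _ _).le.trans hE) _ hs hsE
    rw [D.lang_memb]
    simp only
    rw [hword α hs, if_pos h, List.mem_singleton]

theorem exists_mem_lang (hD : ν.Describes D) {V : ℕ} (hV : ∀ y, ν.var y < V) {E : CExpr 𝓔}
    {s : List 𝓔.Sym} (hs : s ∈ E.language) :
    ∃ S ∈ NFData.substs V (s.map ν.letterNum), ∃ T ∈ D.truths S (ν.codeExpr E),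
      s.map ν.letterNum ∈ D.lang ((S, T), s.length) (ν.codeExpr E) := by
  classical
  obtain ⟨I, r, hs⟩ := hs
  -- Variables whose value fits into `s` are replaced by that value; all other numbers stay formal.
  let σ : ℕ → List ℕ := fun n =>
    if h : ∃ y, ν.var y = n ∧ (r y).Sublist s then (r h.choose).map ν.letterNum
    else [Nat.pair 1 n]
  let S := (List.range V).map σ
  have hσ (y : 𝓔.Var) : S.getD (ν.var y) [] = σ (ν.var y) := by
    simp [S, List.getD, hV]
  have hσ₀ (y : 𝓔.Var) (hy : (r y).Sublist s) : σ (ν.var y) = (r y).map ν.letterNum := by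
    have h : ∃ z, ν.var z = ν.var y ∧ (r z).Sublist s := ⟨y, rfl, hy⟩
    simp only [σ, dif_pos h]
    rw [ν.var.injective h.choose_spec.1]
  let p : ℕ → Prop := fun n =>
    ∃ (k : ℕ) (P : 𝓔.lang.Relations k) (t : Fin k → 𝓔.lang.Term 𝓔.Var),
      D.atomNF S (ν.codeFormula (.atom P t)) = n ∧ I.interp.RelMap P fun i => I.termValue r (t i)
  -- `T` keeps those candidate normal forms that some atom true under `I` and `r` has; being a
  -- filter, it is a sublist of the candidates.
  refine ⟨S, ?_, ((List.range (ν.codeExpr E)).map (D.atomNF S)).filter (fun n => p n),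
    List.mem_sublists'.2 List.filter_sublist,
    map_mem_lang (e₀ := ν.codeExpr E) S hD (fun y => ?_) (fun n => ?_)
      (fun y hy => (hσ y).trans (hσ₀ y hy)) E le_rfl s (.refl s) hs⟩
  · rw [NFData.substs, List.mem_sections, List.forall₂_map_left_iff, List.forall₂_map_right_iff,
      List.forall₂_same]
    intro n _
    simp only [σ]
    split_ifs with h
    · exact List.mem_cons_of_mem _ (List.mem_sublists'.2 (h.choose_spec.2.map _))
    · exact List.mem_cons_self
  · rw [hσ]
    by_cases h : (r y).Sublist s
    · exact .inr (hσ₀ y h)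
    · refine .inl (dif_neg ?_)
      rintro ⟨z, hz, hs⟩
      exact h (ν.var.injective hz ▸ hs)
  · rw [List.mem_filter, decide_eq_true_iff]

end Completeness

end ExprEnv

theorem mainTheorem1 (𝓔 : ExprEnv.{u, v, w, x}) (ν : ExprEnv.Numbering 𝓔) :
    ∃ d : ℕ × ℕ → Bool, Computable d ∧
      ∀ (E : ExprEnv.CExpr 𝓔) (u : List 𝓔.Sym),
        d (ν.codeExpr E, ν.codeWord u) = true ↔ u ∈ E.language := by
  have := 𝓔.finite_var
  obtain ⟨D, hD⟩ := ν.exists_describes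
  obtain ⟨V, hV⟩ := (Set.finite_range ν.var).bddAbove
  -- `V` is only a weak upper bound on the variable numbers, whereas the substitutions cover the
  -- numbers strictly below their parameter.
  refine ⟨D.decideMem (V + 1), (D.primrec_decideMem _).to_comp, fun E s => ?_⟩
  rw [NFData.decideMem, decide_eq_true_iff]
  simp only [ν.inputWord_codeWord, List.length_map, List.mem_flatMap]
  constructor
  · rintro ⟨S, -, T, -, h⟩
    exact ExprEnv.mem_language_of_mem_lang hD S T _ E s h
  · exact fun h => ExprEnv.exists_mem_lang hD (fun y => Nat.lt_succ_of_le (hV ⟨y, rfl⟩)) h
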